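/- Let $n\ge 1$ be an integer and $\beta\in\,]0,1[$. For $m\in\mathbb N_0$ and $p\in[0,1]$ let $\mathrm B_{m,p}$ be the binomial law, and for $p=(p_1,\dots,p_n)\in[0,1]^n$ let $\mathrm{BC}_p$ be the Bernoulli convolution (Poisson-binomial law), that is, the convolution of the Bernoulli laws with success probabilities $p_1,\dots,p_n$; put $\overline p=\frac1n\sum_{j=1}^n p_j$. For $\gamma\in\,]0,1[$ and $x\in\{1,\dots,n\}$ let $g_{n,\gamma}(x)$ be the unique $p\in[0,1]$ with $\mathrm B_{n,p}(\{x,\dots,n\})=1-\gamma$. Define the Clopper–Pearson upray by $$\mathrm K_{\mathrm{CP},n,\gamma}(0)=[0,1],\qquad \mathrm K_{\mathrm{CP},n,\gamma}(x)=\,]g_{n,\gamma}(x),1]\quad\text{for }x\in\{1,\dots,n\},$$ the Clopper–Pearson downray by $\Lambda_{\mathrm{CP},n,\gamma}(x)=\{1-q: q\in \mathrm K_{\mathrm{CP},n,\gamma}(n-x)\}$ for $x\in\{0,\dots,n\}$, and the two-sided Clopper–Pearson interval by $$\mathrm M_{\mathrm{CP},n}(x)=\mathrm K_{\mathrm{CP},n,\frac{1+\beta}2}(x)\cap\Lambda_{\mathrm{CP},n,\frac{1+\beta}2}(x)\quad\text{for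 }x\in\{0,\dots,n\}.$$ Put $\beta_n=\mathrm B_{n,1/n}(\{0,1\})$. If $\beta\ge 2\beta_n-1$ or $n=1$, then $\mathrm M_{\mathrm{CP},n}$ is a $\beta$-confidence interval for the average success probability in the model $(\mathrm{BC}_p : p\in[0,1]^n)$; that is, each $\mathrm M_{\mathrm{CP},n}(x)$ is an interval and $$\mathrm{BC}_p\big(\{x\in\{0,\dots,n\}:\overline p\in \mathrm M_{\mathrm{CP},n}(x)\}\big)\ \ge\ \beta\qquad\text{for every }p\in[0,1]^n .$$ The condition "$\beta\ge 2\beta_n-1$ or $n=1$", and hence this conclusion, holds in particular whenever $\beta\ge\frac12$. -/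

import Mathlib

open MeasureTheory ProbabilityTheory unitInterval

/-- The Bernoulli law on `ℕ` with success probability `p`: mass `p` at `1`, mass `1 - p` at `0`. -/
noncomputable def bernoulliLaw (p : I) : Measure ℕ :=
  bernoulliMeasure 1 0 p

/-- The Bernoulli convolution (Poisson-binomial law) with success probabilities `p₁, …, pₙ`:
the convolution of the Bernoulli laws with these parameters (the point mass at `0` if `n = 0`). -/
noncomputable def bernoulliConvolution : (n : ℕ) → (Fin n → I) → Measure ℕ
  | 0, _ => Measure.dirac 0
  | n + 1, p =>
      Measure.conv (bernoulliConvolution n fun j => p j.castSucc) (bernoulliLaw (p (Fin.last n)))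

/-- The average success probability `(p₁ + ⋯ + pₙ) / n`, as a point of `[0,1]`. -/
noncomputable def averageProb {n : ℕ} (p : Fin n → I) : I :=
  ⟨(∑ j, (p j : ℝ)) / n, div_nonneg (Finset.sum_nonneg fun j _ => (p j).2.1) n.cast_nonneg,
    div_le_one_of_le₀
      ((Finset.sum_le_sum fun j _ => (p j).2.2).trans (by simp)) n.cast_nonneg⟩

/-- `K : {0, …, n} → 2^Γ` is a `β`-confidence region for the estimation problem
`((P θ : θ ∈ Θ), κ)`, with the laws `P θ` living on `{0, …, n} ⊆ ℕ`, if
`P θ {x ∈ {0, …, n} : K x ∋ κ θ} ≥ β` for every `θ`. -/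
def IsConfidenceRegion {Θ Γ : Type*} {n : ℕ} (P : Θ → Measure ℕ) (κ : Θ → Γ) (β : ℝ)
    (K : Fin (n + 1) → Set Γ) : Prop :=
  ∀ θ, β ≤ (P θ).real (Fin.val '' {x : Fin (n + 1) | κ θ ∈ K x})

/-- A confidence interval is a confidence region each of whose values is an interval. -/
def IsConfidenceInterval {Θ : Type*} {n : ℕ} (P : Θ → Measure ℕ) (κ : Θ → I) (β : ℝ)
    (K : Fin (n + 1) → Set I) : Prop :=
  IsConfidenceRegion P κ β K ∧ ∀ x, (K x).OrdConnected

/-- `g_{n,β}(x)`: the `p ∈ [0,1]` with `B_{n,p}({x, …, n}) = 1 - β`. For `0 < β < 1` and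
`1 ≤ x ≤ n` there is exactly one such `p`, see `binomial_tail_eq_iff`. -/
noncomputable def clopperPearsonBound (n : ℕ) (β : ℝ) (x : ℕ) : I :=
  sInf {p : I | (binomial n p).real (Set.Icc x n) = 1 - β}

/-- The Clopper–Pearson `β`-confidence upray: `[0,1]` at `0`, and `]g_{n,β}(x), 1]` at
`x ∈ {1, …, n}`. -/
noncomputable def clopperPearsonUpray (n : ℕ) (β : ℝ) (x : Fin (n + 1)) : Set I :=
  if x = 0 then Set.univ else Set.Ioc (clopperPearsonBound n β x) 1

/-- The Clopper–Pearson `β`-confidence downray: `1 - K(n - x)`, with `K` the upray. -/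
noncomputable def clopperPearsonDownray (n : ℕ) (β : ℝ) (x : Fin (n + 1)) : Set I :=
  σ '' clopperPearsonUpray n β x.rev

/-- The two-sided Clopper–Pearson `β`-confidence interval for the binomial problem. -/
noncomputable def clopperPearsonTwoSided (n : ℕ) (β : ℝ) (x : Fin (n + 1)) : Set I :=
  clopperPearsonUpray n ((1 + β) / 2) x ∩ clopperPearsonDownray n ((1 + β) / 2) x

/-- `β_n = B_{n,1/n}({0, 1})`. -/
noncomputable def betaThreshold (n : ℕ) : ℝ :=
  (binomial n ⟨1 / (n : ℝ), by positivity, by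
    simpa using Nat.cast_inv_le_one n⟩).real {0, 1}

lemma binomial_real_Icc (n x : ℕ) (p : I) :
    (binomial n p).real (Set.Icc x n)
      = ∑ k ∈ Finset.Icc x n, (bernsteinPolynomial ℝ n k).eval (p : ℝ) := by
  rw [← Finset.coe_Icc, ← sum_measureReal_singleton]
  refine Finset.sum_congr rfl fun k _ => ?_
  rw [binomial_real_singleton]
  simp [bernsteinPolynomial]

lemma derivative_bernstein_tail (n x : ℕ) (hx : x ≤ n) :
    Polynomial.derivative (∑ k ∈ Finset.Icc (x + 1) (n + 1), bernsteinPolynomial ℝ (n + 1) k)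
      = (n + 1 : ℝ) • bernsteinPolynomial ℝ n x := by
  induction hx using Nat.decreasingInduction with
  | self =>
    simp [bernsteinPolynomial.derivative_succ, bernsteinPolynomial.eq_zero_of_lt,
      Polynomial.smul_eq_C_mul]
  | of_succ k hk ih =>
    rw [← Finset.add_sum_Ioc_eq_sum_Icc (by omega), Polynomial.derivative_add,
      ← Finset.Icc_add_one_left_eq_Ioc, ih, bernsteinPolynomial.derivative_succ]
    simp [Polynomial.smul_eq_C_mul]
    ring

/-- For `0 < β < 1` and `1 ≤ x ≤ n`, the bound `g_{n,β}(x)` is the one and only `p ∈ [0,1]` with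
`B_{n,p}({x, …, n}) = 1 - β`. -/
lemma binomial_tail_eq_iff {n x : ℕ} {β : ℝ} (hβ : β ∈ Set.Ioo (0 : ℝ) 1) (hx : 1 ≤ x)
    (hxn : x ≤ n) (p : I) :
    (binomial n p).real (Set.Icc x n) = 1 - β ↔ p = clopperPearsonBound n β x := by
  obtain ⟨m, rfl⟩ : ∃ m, n = m + 1 := ⟨n - 1, by omega⟩
  obtain ⟨y, rfl⟩ : ∃ y, x = y + 1 := ⟨x - 1, by omega⟩
  set q : Polynomial ℝ :=
    ∑ k ∈ Finset.Icc (y + 1) (m + 1), bernsteinPolynomial ℝ (m + 1) k with hq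
  have hT : ∀ p : I, (binomial (m + 1) p).real (Set.Icc (y + 1) (m + 1)) = q.eval (p : ℝ) := by
    intro p
    rw [binomial_real_Icc, hq, Polynomial.eval_finsetSum]
  have hmono : StrictMonoOn (fun t : ℝ => q.eval t) (Set.Icc 0 1) := by
    refine strictMonoOn_of_deriv_pos (convex_Icc 0 1) q.continuous.continuousOn ?_
    intro t ht
    rw [interior_Icc] at ht
    rw [Polynomial.deriv, hq, derivative_bernstein_tail m y (by omega)]
    have h1 : 0 < 1 - t := by linarith [ht.2]
    have h2 : (0 : ℝ) < m.choose y := by exact_mod_cast Nat.choose_pos (by omega)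
    have h3 := ht.1
    simp only [bernsteinPolynomial, Polynomial.eval_smul, Polynomial.eval_mul,
      Polynomial.eval_natCast, Polynomial.eval_pow, Polynomial.eval_X, Polynomial.eval_sub,
      Polynomial.eval_one, smul_eq_mul]
    positivity
  have h0 : q.eval 0 = 0 := by
    rw [hq, Polynomial.eval_finsetSum]
    refine Finset.sum_eq_zero fun k hk => ?_
    rw [bernsteinPolynomial.eval_at_0, if_neg]
    have := (Finset.mem_Icc.1 hk).1
    omega
  have h1 : q.eval 1 = 1 := by
    rw [hq, Polynomial.eval_finsetSum]
    simp only [bernsteinPolynomial.eval_at_1]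
    simp
    omega
  have hex : 1 - β ∈ (fun t : ℝ => q.eval t) '' Set.Icc 0 1 := by
    apply intermediate_value_Icc zero_le_one q.continuous.continuousOn
    simp only [h0, h1]
    exact ⟨by linarith [hβ.2], by linarith [hβ.1]⟩
  obtain ⟨t, ht, hqt⟩ := hex
  have hset : {p : I | (binomial (m + 1) p).real (Set.Icc (y + 1) (m + 1)) = 1 - β}
      = {⟨t, ht⟩} := by
    ext p
    simp only [Set.mem_ofPred_eq, Set.mem_singleton_iff, hT, ← hqt]
    constructor
    · intro h
      exact Subtype.ext (hmono.injOn p.2 ht h)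
    · rintro rfl
      rfl
  have hg : clopperPearsonBound (m + 1) β (y + 1) = ⟨t, ht⟩ := by
    rw [clopperPearsonBound, hset, sInf_singleton]
  rw [hg]
  simpa using Set.ext_iff.1 hset p

/-!
Write `q` for the average success probability and call `x ≥ 1` *missed* if the binomial law with
parameters `n, q` gives `{x, …, n}` at most the mass `(1 - β) / 2`; these are the `x` at which the
upper of the two rays does not contain `q` (`mem_clopperPearsonUpray_iff`). The lower ray is the
same thing with successes and failures exchanged, so the two-sided interval covers with probability
at least `1 - P(missed) - P'(missed)`, the second term belonging to the parameters `1 - pⱼ`.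

The main tool is Hoeffding's inequality (`lowerTail_binomial_le`): if `∑ pⱼ ≤ y`, then the Bernoulli
convolution gives `{0, …, y}` at least the mass that the binomial law with the same mean does. For
the proof, take among the minimisers of this mass on the slice of the cube with given parameter sum
one with the least sum of squares. As a function of two parameters with fixed sum, the tail is
affine in their product, with slope `Q_y - Q_{y-1}`, where `Q` is the mass function of the sum of
the others (`lowerTail_pair_sub`). If two parameters differ, minimality forces a positive slope, and
then not both lie in the open unit interval. So all parameters are `0`, `1` or one further value
`a`, the sum of the others is a shifted binomial variable, and its mass function is
nonincreasing at `y` (`coeff_succ_le_coeff_X_pow_mul`): a contradiction.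

If the smallest missed `x` is at least `n q + 1`, then Hoeffding's inequality yields
`P(missed) ≤ (1 - β) / 2`. Under the condition on `β` the only other possibility is `x = 1` with
`n q < 1` (`lt_binomial_real_Icc_of_lt_mean_add_one`): the binomial law with mean `k` gives
`{k + 1, …, n}` at least the mass `1 - βₙ` for `1 ≤ k < n`. This is again a consequence of
Hoeffding's inequality, applied to a binomial law with an impossible or a certain trial added; it
reduces `k ≥ 2` to three trials with mean `2`, and `βₙ ≤ 3 / 4` to two trials with mean `1`. In the
exceptional case `P(missed)` is at most `n q ≤ 2 (1 - (1 - q) ^ n) ≤ 1 - β`, and nothing is missed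
on the other side (`exceptional_missedObservations`).
-/

open Polynomial

/-! ### Generating polynomials of Bernoulli convolutions -/

/-- The generating polynomial `∏ᵢ (1 - pᵢ + pᵢ X)` of the sum of independent Bernoulli variables
with parameters `pᵢ`, `i ∈ s`; written in powers of `X - 1`, because the factors are then affine in
`pᵢ` with constant term `1`. -/
noncomputable def bernoulliGF {ι : Type*} (s : Finset ι) (p : ι → ℝ) : ℝ[X] :=
  ∏ i ∈ s, (1 + C (p i) * (X - 1))

/-- The sum of the coefficients of degree at most `y`: for the generating polynomial of a law on
`ℕ`, the mass of `{0, …, y}`. -/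
noncomputable def lowerTail (y : ℕ) : ℝ[X] →ₗ[ℝ] ℝ :=
  ∑ k ∈ Finset.range (y + 1), lcoeff ℝ k

lemma lowerTail_apply (y : ℕ) (F : ℝ[X]) :
    lowerTail y F = ∑ k ∈ Finset.range (y + 1), F.coeff k := by
  simp [lowerTail]

lemma coeff_succ_X_sub_one_mul (F : ℝ[X]) (k : ℕ) :
    ((X - 1) * F).coeff (k + 1) = F.coeff k - F.coeff (k + 1) := by
  simp [sub_mul]

lemma lowerTail_X_sub_one_mul (y : ℕ) (F : ℝ[X]) :
    lowerTail y ((X - 1) * F) = -F.coeff y := by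
  rw [lowerTail_apply]
  induction y with
  | zero => simp [sub_mul]
  | succ y ih =>
    rw [Finset.sum_range_succ, ih, coeff_succ_X_sub_one_mul]
    ring

lemma lowerTail_succ_X_mul (y : ℕ) (F : ℝ[X]) :
    lowerTail (y + 1) (X * F) = lowerTail y F := by
  rw [lowerTail_apply, lowerTail_apply, Finset.sum_range_succ']
  simp

/-- Two generating polynomials that differ in the two parameters `a, b` only, with the same sum
`a + b`, have lower tails whose difference is governed by the change of the product `a * b`. -/
lemma lowerTail_pair_sub (y : ℕ) (Q : ℝ[X]) {a b a' b' : ℝ} (h : a' + b' = a + b) :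
    lowerTail (y + 1) ((1 + C a' * (X - 1)) * ((1 + C b' * (X - 1)) * Q))
      - lowerTail (y + 1) ((1 + C a * (X - 1)) * ((1 + C b * (X - 1)) * Q))
      = (a' * b' - a * b) * (Q.coeff (y + 1) - Q.coeff y) := by
  have key : (1 + C a' * (X - 1)) * ((1 + C b' * (X - 1)) * Q)
      - (1 + C a * (X - 1)) * ((1 + C b * (X - 1)) * Q)
      = (a' * b' - a * b) • ((X - 1) * ((X - 1) * Q)) := by
    have hC : (C a' + C b' : ℝ[X]) = C a + C b := by rw [← C_add, h, C_add]
    rw [smul_eq_C_mul, C_sub, C_mul, C_mul]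
    linear_combination ((X - 1) * Q) * hC
  rw [← map_sub, key, map_smul, lowerTail_X_sub_one_mul, coeff_succ_X_sub_one_mul, smul_eq_mul]
  ring

lemma bernoulliGF_eq_pair {ι : Type*} [DecidableEq ι] {s : Finset ι} {i j : ι} (hi : i ∈ s)
    (hj : j ∈ s) (hij : i ≠ j) (p : ι → ℝ) :
    bernoulliGF s p = (1 + C (p i) * (X - 1)) *
      ((1 + C (p j) * (X - 1)) * bernoulliGF ((s.erase i).erase j) p) := by
  rw [bernoulliGF, ← Finset.mul_prod_erase s _ hi,
    ← Finset.mul_prod_erase (s.erase i) _ (Finset.mem_erase.2 ⟨hij.symm, hj⟩), bernoulliGF]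

lemma continuous_coeff_bernoulliGF {ι : Type*} (s : Finset ι) (k : ℕ) :
    Continuous fun p : ι → ℝ => (bernoulliGF s p).coeff k := by
  classical
  induction s using Finset.induction_on generalizing k with
  | empty => simpa [bernoulliGF] using continuous_const
  | insert i s hi ih =>
    have : ∀ p : ι → ℝ, bernoulliGF (insert i s) p
        = bernoulliGF s p + C (p i) * ((X - 1) * bernoulliGF s p) := by
      intro p
      rw [bernoulliGF, Finset.prod_insert hi, ← bernoulliGF]
      ring
    simp only [this, coeff_add, coeff_C_mul]
    refine (ih k).add ((continuous_apply i).mul ?_)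
    cases k with
    | zero => simpa [sub_mul] using (ih 0).fun_neg
    | succ k => simpa only [coeff_succ_X_sub_one_mul] using (ih k).fun_sub (ih (k + 1))

lemma continuous_lowerTail_bernoulliGF {ι : Type*} (s : Finset ι) (y : ℕ) :
    Continuous fun p : ι → ℝ => lowerTail y (bernoulliGF s p) := by
  simp only [lowerTail_apply]
  exact continuous_finsetSum _ fun k _ => continuous_coeff_bernoulliGF s k

/-- The generating polynomial of a binomial law. -/
lemma one_add_C_mul_pow_eq_sum (a : ℝ) (n : ℕ) :
    (1 + C a * (X - 1)) ^ n
      = ∑ k ∈ Finset.range (n + 1), C ((bernsteinPolynomial ℝ n k).eval a) * X ^ k := by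
  have : (1 + C a * (X - 1) : ℝ[X]) = C a * X + C (1 - a) := by
    rw [C_sub, C_1]
    ring
  rw [this, add_pow]
  refine Finset.sum_congr rfl fun k _ => ?_
  simp only [bernsteinPolynomial, eval_mul, eval_natCast, eval_pow, eval_X, eval_sub, eval_one,
    C_mul, C_pow, mul_pow, map_natCast]
  ring

lemma coeff_one_add_C_mul_pow (a : ℝ) (n k : ℕ) :
    ((1 + C a * (X - 1)) ^ n).coeff k = (bernsteinPolynomial ℝ n k).eval a := by
  rw [one_add_C_mul_pow_eq_sum, finsetSum_coeff]
  simp only [coeff_C_mul, coeff_X_pow, mul_ite, mul_one, mul_zero]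
  rw [Finset.sum_ite_eq]
  split_ifs with h
  · rfl
  · rw [bernsteinPolynomial.eq_zero_of_lt ℝ (by simpa using h), eval_zero]

/-- The binomial masses of parameters `r, a` are nonincreasing from `(r + 1) * a - 1` on. -/
lemma coeff_succ_le_coeff_one_add_C_mul_pow {a : ℝ} (ha : 0 < a) (ha1 : a < 1) {r z : ℕ}
    (h : (r + 1) * a ≤ z + 1) :
    ((1 + C a * (X - 1)) ^ r).coeff (z + 1) ≤ ((1 + C a * (X - 1)) ^ r).coeff z := by
  simp only [coeff_one_add_C_mul_pow]
  have ha1' : 0 < 1 - a := by linarith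
  rcases lt_or_ge r (z + 1) with hr | hr
  · rw [bernsteinPolynomial.eq_zero_of_lt ℝ hr]
    simp only [bernsteinPolynomial, eval_mul, eval_natCast, eval_pow, eval_X, eval_sub, eval_one,
      eval_zero]
    positivity
  · obtain ⟨d, rfl⟩ := Nat.exists_eq_add_of_le hr
    have hch : ((z + 1 + d).choose (z + 1) : ℝ) * (z + 1) = (z + 1 + d).choose z * (d + 1) := by
      have := Nat.choose_succ_right_eq (z + 1 + d) z
      rw [show z + 1 + d - z = d + 1 by omega] at this
      exact_mod_cast this
    simp only [bernsteinPolynomial, eval_mul, eval_natCast, eval_pow, eval_X, eval_sub, eval_one]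
    rw [show z + 1 + d - (z + 1) = d by omega, show z + 1 + d - z = d + 1 by omega]
    have h1 : ((z + 1 + d).choose (z + 1) : ℝ) * a ≤ (z + 1 + d).choose z * (1 - a) := by
      have hz : (0 : ℝ) < z + 1 := by positivity
      refine le_of_mul_le_mul_right ?_ hz
      have hc : (0 : ℝ) ≤ (z + 1 + d).choose z := by positivity
      push_cast at h
      nlinarith
    have h2 : (0 : ℝ) ≤ a ^ z * (1 - a) ^ d := by positivity
    calc _ = ((z + 1 + d).choose (z + 1) * a) * (a ^ z * (1 - a) ^ d) := by ring
      _ ≤ ((z + 1 + d).choose z * (1 - a)) * (a ^ z * (1 - a) ^ d) :=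
        mul_le_mul_of_nonneg_right h1 h2
      _ = _ := by ring

/-- If all parameters are `0`, `1` or `a`, then the sum is a binomial variable shifted by the
number `u` of ones. -/
lemma exists_bernoulliGF_eq_X_pow_mul {ι : Type*} (s : Finset ι) {p : ι → ℝ} {a : ℝ}
    (hp : ∀ i ∈ s, p i = 0 ∨ p i = 1 ∨ p i = a) :
    ∃ u r : ℕ, bernoulliGF s p = X ^ u * (1 + C a * (X - 1)) ^ r ∧
      ∑ i ∈ s, p i = u + r * a := by
  classical
  induction s using Finset.induction_on with
  | empty => exact ⟨0, 0, by simp [bernoulliGF], by simp⟩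
  | insert i s hi ih =>
    obtain ⟨u, r, h1, h2⟩ := ih fun j hj => hp j (Finset.mem_insert_of_mem hj)
    have h3 : bernoulliGF (insert i s) p = (1 + C (p i) * (X - 1)) * bernoulliGF s p := by
      rw [bernoulliGF, Finset.prod_insert hi, ← bernoulliGF]
    rw [Finset.sum_insert hi, h3, h1, h2]
    rcases hp i (Finset.mem_insert_self i s) with h | h | h
    · exact ⟨u, r, by simp [h], by simp [h]⟩
    · exact ⟨u + 1, r, by rw [h, C_1]; ring, by rw [h]; push_cast; ring⟩
    · exact ⟨u, r + 1, by rw [h]; ring, by rw [h]; push_cast; ring⟩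

/-- A shifted binomial law has a nonincreasing mass function from slightly below its mean on. -/
lemma coeff_succ_le_coeff_X_pow_mul {a : ℝ} (ha : 0 < a) (ha1 : a < 1) {u r y : ℕ}
    (h : u + (r + 1) * a ≤ y + 1) :
    (X ^ u * (1 + C a * (X - 1)) ^ r).coeff (y + 1)
      ≤ (X ^ u * (1 + C a * (X - 1)) ^ r).coeff y := by
  have hu : u ≤ y := by
    have : (u : ℝ) < y + 1 := by nlinarith [mul_pos (Nat.cast_add_one_pos (α := ℝ) r) ha]
    have : u < y + 1 := by exact_mod_cast this
    omega
  obtain ⟨z, rfl⟩ := Nat.exists_eq_add_of_le hu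
  rw [show u + z + 1 = (z + 1) + u by ring, show u + z = z + u by ring, coeff_X_pow_mul,
    coeff_X_pow_mul]
  refine coeff_succ_le_coeff_one_add_C_mul_pow ha ha1 ?_
  push_cast at h
  linarith

/-! ### Hoeffding's inequality -/

/-- Changing two of the parameters without changing their sum. -/
lemma lowerTail_bernoulliGF_exchange {ι : Type*} [Fintype ι] [DecidableEq ι] {i j : ι}
    (hij : i ≠ j) (q : ι → ℝ) {a b : ℝ} (hab : a + b = q i + q j) (y : ℕ) :
    lowerTail (y + 1) (bernoulliGF Finset.univ (Function.update (Function.update q i a) j b))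
      - lowerTail (y + 1) (bernoulliGF Finset.univ q)
      = (a * b - q i * q j) * ((bernoulliGF ((Finset.univ.erase i).erase j) q).coeff (y + 1)
          - (bernoulliGF ((Finset.univ.erase i).erase j) q).coeff y) := by
  have hQ : bernoulliGF ((Finset.univ.erase i).erase j)
      (Function.update (Function.update q i a) j b)
      = bernoulliGF ((Finset.univ.erase i).erase j) q := by
    refine Finset.prod_congr rfl fun k hk => ?_
    simp only [Finset.mem_erase] at hk
    rw [Function.update_of_ne hk.1, Function.update_of_ne hk.2.1]
  rw [bernoulliGF_eq_pair (Finset.mem_univ i) (Finset.mem_univ j) hij q,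
    bernoulliGF_eq_pair (Finset.mem_univ i) (Finset.mem_univ j) hij
      (Function.update (Function.update q i a) j b), hQ, Function.update_self,
    Function.update_of_ne hij, Function.update_self]
  exact lowerTail_pair_sub y _ hab

lemma sum_comp_update_update {ι : Type*} [Fintype ι] [DecidableEq ι] {i j : ι}
    (hij : i ≠ j) (q : ι → ℝ) (a b : ℝ) (f : ℝ → ℝ) :
    ∑ k, f (Function.update (Function.update q i a) j b k)
      = ∑ k, f (q k) + (f a + f b - f (q i) - f (q j)) := by
  have hj : j ∈ Finset.univ.erase i := Finset.mem_erase.2 ⟨hij.symm, Finset.mem_univ j⟩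
  rw [← Finset.add_sum_erase _ _ (Finset.mem_univ i), ← Finset.add_sum_erase _ _ hj,
    ← Finset.add_sum_erase _ (fun k => f (q k)) (Finset.mem_univ i),
    ← Finset.add_sum_erase _ (fun k => f (q k)) hj]
  rw [Function.update_self, Function.update_of_ne hij, Function.update_self,
    Finset.sum_congr rfl (g := fun k => f (q k))]
  · ring
  · intro k hk
    simp only [Finset.mem_erase] at hk
    rw [Function.update_of_ne hk.1, Function.update_of_ne hk.2.1]

/-- The parameter vectors in the cube with sum `s`. -/
def cubeSlice (ι : Type*) [Fintype ι] (s : ℝ) : Set (ι → ℝ) :=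
  {p | (∀ i, p i ∈ Set.Icc (0 : ℝ) 1) ∧ ∑ i, p i = s}

lemma isCompact_cubeSlice (ι : Type*) [Fintype ι] (s : ℝ) : IsCompact (cubeSlice ι s) := by
  have h1 : IsCompact (Set.univ.pi fun _ : ι => Set.Icc (0 : ℝ) 1) :=
    isCompact_univ_pi fun _ => isCompact_Icc
  have h2 : IsClosed {p : ι → ℝ | ∑ i, p i = s} := isClosed_eq (by fun_prop) continuous_const
  have : cubeSlice ι s = (Set.univ.pi fun _ : ι => Set.Icc (0 : ℝ) 1) ∩ {p | ∑ i, p i = s} := by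
    ext p
    simp only [cubeSlice, Set.mem_ofPred_eq, Set.mem_inter_iff, Set.mem_univ_pi]
  rw [this]
  exact h1.inter_right h2

/-- Among the minimisers of the lower tail on a slice of the cube, one with the least sum of squares
is constant, provided that the tail reaches up to the mean. -/
lemma eq_of_isMinimizer {ι : Type*} [Fintype ι] {s : ℝ} {y : ℕ} (hs : s ≤ y) {q : ι → ℝ}
    (hq : q ∈ cubeSlice ι s)
    (hmin : ∀ q' ∈ cubeSlice ι s,
      lowerTail y (bernoulliGF Finset.univ q) ≤ lowerTail y (bernoulliGF Finset.univ q'))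
    (hsq : ∀ q' ∈ cubeSlice ι s,
      lowerTail y (bernoulliGF Finset.univ q') = lowerTail y (bernoulliGF Finset.univ q) →
      ∑ k, q k ^ 2 ≤ ∑ k, q' k ^ 2) (i j : ι) : q i = q j := by
  classical
  have h0 := fun k => (hq.1 k).1
  have h1 := fun k => (hq.1 k).2
  by_contra hne
  wlog hlt : q i < q j generalizing i j
  · exact this j i (Ne.symm hne) (lt_of_le_of_ne (not_lt.1 hlt) (Ne.symm hne))
  obtain _ | y := y
  · have hs0 : ∑ k, q k = 0 :=
      le_antisymm (by rw [hq.2]; simpa using hs) (Finset.sum_nonneg fun k _ => h0 k)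
    have hz := (Finset.sum_eq_zero_iff_of_nonneg fun k _ => h0 k).1 hs0
    exact hne (by rw [hz i (Finset.mem_univ i), hz j (Finset.mem_univ j)])
  have exch : ∀ i j : ι, i ≠ j → ∀ a b : ℝ, a ∈ Set.Icc (0 : ℝ) 1 → b ∈ Set.Icc (0 : ℝ) 1 →
      a + b = q i + q j → ∀ δ : ℝ,
      δ = (bernoulliGF ((Finset.univ.erase i).erase j) q).coeff (y + 1)
          - (bernoulliGF ((Finset.univ.erase i).erase j) q).coeff y →
      0 ≤ (a * b - q i * q j) * δ ∧ ((a * b - q i * q j) * δ = 0 → a * b ≤ q i * q j) := by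
    intro i j hij a b ha hb hab δ hδ
    have hex := lowerTail_bernoulliGF_exchange hij q hab y
    rw [← hδ] at hex
    have hmem : Function.update (Function.update q i a) j b ∈ cubeSlice ι s := by
      refine ⟨fun k => ?_, ?_⟩
      · rcases eq_or_ne k j with rfl | hkj
        · simpa using hb
        · rw [Function.update_of_ne hkj]
          rcases eq_or_ne k i with rfl | hki
          · simpa using ha
          · rw [Function.update_of_ne hki]
            exact hq.1 k
      · have := sum_comp_update_update hij q a b id
        simp only [id] at this
        rw [this, hq.2]
        linarith
    refine ⟨?_, fun h => ?_⟩
    · rw [← hex]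
      exact sub_nonneg.2 (hmin _ hmem)
    · have h3 := hsq _ hmem (by linarith)
      rw [sum_comp_update_update hij q a b (· ^ 2)] at h3
      have h4 : (a + b) ^ 2 = (q i + q j) ^ 2 := by rw [hab]
      nlinarith
  have pos : ∀ i j : ι, q i < q j → 0 <
      (bernoulliGF ((Finset.univ.erase i).erase j) q).coeff (y + 1)
        - (bernoulliGF ((Finset.univ.erase i).erase j) q).coeff y := by
    intro i j hlt
    -- Replacing both values by their mean increases their product and decreases the sum of squares.
    have hm : (q i + q j) / 2 ∈ Set.Icc (0 : ℝ) 1 :=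
      ⟨by linarith [h0 i, h0 j], by linarith [h1 i, h1 j]⟩
    obtain ⟨h2, h3⟩ := exch i j (fun h => hlt.ne (congrArg q h)) _ _ hm hm (by ring) _ rfl
    have h4 : 0 < (q i + q j) / 2 * ((q i + q j) / 2) - q i * q j := by
      nlinarith [mul_pos (sub_pos.2 hlt) (sub_pos.2 hlt)]
    refine lt_of_le_of_ne (nonneg_of_mul_nonneg_right h2 h4) fun h => ?_
    rw [← h, mul_zero] at h3
    linarith [h3 rfl]
  have notint : ∀ i j : ι, q i < q j → 0 < q i → q j < 1 → False := by
    intro i j hlt hi hj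
    -- Moving the two values apart decreases their product, hence the tail.
    obtain ⟨ε, hε, hε'⟩ := exists_between (lt_min hi (sub_pos.2 hj))
    rw [lt_min_iff] at hε'
    obtain ⟨h2, -⟩ := exch i j (fun h => hlt.ne (congrArg q h)) (q i - ε) (q j + ε)
      ⟨by linarith, by linarith [h1 i]⟩ ⟨by linarith [h0 j], by linarith⟩ (by ring) _ rfl
    have h3 : (q i - ε) * (q j + ε) - q i * q j < 0 := by nlinarith
    nlinarith [pos i j hlt]
  obtain ⟨a, ha, ha1, hval⟩ : ∃ a : ℝ, 0 < a ∧ a < 1 ∧ ∀ k, q k = 0 ∨ q k = 1 ∨ q k = a := by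
    by_cases hex : ∃ k, 0 < q k ∧ q k < 1
    · obtain ⟨k, hk, hk'⟩ := hex
      refine ⟨q k, hk, hk', fun l => ?_⟩
      rcases (h0 l).eq_or_lt with hl | hl
      · exact Or.inl hl.symm
      rcases (h1 l).eq_or_lt with hl' | hl'
      · exact Or.inr (Or.inl hl')
      rcases lt_trichotomy (q l) (q k) with h | h | h
      · exact (notint l k h hl hk').elim
      · exact Or.inr (Or.inr h)
      · exact (notint k l h hk hl').elim
    · push Not at hex
      refine ⟨1 / 2, by norm_num, by norm_num, fun l => ?_⟩
      rcases (h0 l).eq_or_lt with hl | hl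
      · exact Or.inl hl.symm
      · exact Or.inr (Or.inl (le_antisymm (h1 l) (hex l hl)))
  have hδ := pos i j hlt
  have hij : i ≠ j := fun h => hlt.ne (congrArg q h)
  obtain ⟨u, r, hGF, hsum⟩ := exists_bernoulliGF_eq_X_pow_mul ((Finset.univ.erase i).erase j)
    (p := q) (a := a) fun k _ => hval k
  have htot : q i + (q j + (u + r * a)) = s := by
    rw [← hsum, ← hq.2, Finset.add_sum_erase _ _ (Finset.mem_erase.2 ⟨hij.symm, Finset.mem_univ j⟩),
      Finset.add_sum_erase _ _ (Finset.mem_univ i)]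
  have hja : a ≤ q j := by
    rcases hval j with h | h | h
    · linarith [h0 i]
    · linarith
    · exact h.ge
  rw [hGF] at hδ
  push_cast at hs
  linarith [coeff_succ_le_coeff_X_pow_mul ha ha1 (u := u) (r := r) (y := y)
    (by linarith [h0 i])]

/-- **Hoeffding's inequality** for Bernoulli convolutions: from the mean on, the lower tail of a
Bernoulli convolution is at least that of the binomial law with the same mean. -/
theorem lowerTail_binomial_le {ι : Type*} [Fintype ι] {p : ι → ℝ}
    (hp : ∀ i, p i ∈ Set.Icc (0 : ℝ) 1) {y : ℕ} (hy : ∑ i, p i ≤ y) :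
    lowerTail y ((1 + C ((∑ i, p i) / Fintype.card ι) * (X - 1)) ^ Fintype.card ι)
      ≤ lowerTail y (bernoulliGF Finset.univ p) := by
  have hpmem : p ∈ cubeSlice ι (∑ i, p i) := ⟨hp, rfl⟩
  have hT : Continuous fun q : ι → ℝ => lowerTail y (bernoulliGF Finset.univ q) :=
    continuous_lowerTail_bernoulliGF _ y
  obtain ⟨q₁, hq₁, hmin⟩ :=
    (isCompact_cubeSlice ι (∑ i, p i)).exists_isMinOn ⟨p, hpmem⟩ hT.continuousOn
  obtain ⟨q, ⟨hq, hqT⟩, hsq⟩ := ((isCompact_cubeSlice ι (∑ i, p i)).inter_right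
    (isClosed_eq hT (continuous_const (y := lowerTail y (bernoulliGF Finset.univ q₁))))
    ).exists_isMinOn ⟨q₁, hq₁, rfl⟩ (f := fun q : ι → ℝ => ∑ k, q k ^ 2)
    (by fun_prop)
  rw [isMinOn_iff] at hmin hsq
  replace hqT : lowerTail y (bernoulliGF Finset.univ q) = lowerTail y (bernoulliGF Finset.univ q₁) :=
    hqT
  have hconst := eq_of_isMinimizer hy hq (fun q' hq' => hqT.trans_le (hmin q' hq'))
    fun q' hq' h => hsq q' ⟨hq', h.trans hqT⟩
  have hval : ∀ k, q k = (∑ i, p i) / Fintype.card ι := by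
    intro k
    have : Nonempty ι := ⟨k⟩
    have hc : (Fintype.card ι : ℝ) ≠ 0 := by exact_mod_cast Fintype.card_ne_zero
    rw [← hq.2, Finset.sum_congr rfl fun i _ => hconst i k]
    simp only [Finset.sum_const, Finset.card_univ, nsmul_eq_mul]
    field_simp
  have hGF : bernoulliGF Finset.univ q
      = (1 + C ((∑ i, p i) / Fintype.card ι) * (X - 1)) ^ Fintype.card ι := by
    rw [bernoulliGF, Finset.prod_congr rfl fun k _ => by rw [hval k]]
    simp
  rw [← hGF, hqT]
  exact hmin p hpmem

/-! ### Binomial laws with integer mean -/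

lemma bernoulliGF_univ_cons {n : ℕ} (e : ℝ) (p : Fin n → ℝ) :
    bernoulliGF Finset.univ (Fin.cons e p : Fin (n + 1) → ℝ)
      = (1 + C e * (X - 1)) * bernoulliGF Finset.univ p := by
  simp [bernoulliGF, Fin.prod_univ_succ]

/-- Hoeffding's inequality for `n` equal parameters `k / n` and one parameter `e`. -/
lemma lowerTail_succ_pow_le {n k : ℕ} (hn : 1 ≤ n) (hk : k ≤ n) {e : ℝ}
    (he : e ∈ Set.Icc (0 : ℝ) 1) {y : ℕ} (hy : e + k ≤ y) :
    lowerTail y ((1 + C ((e + k) / (n + 1 : ℕ)) * (X - 1)) ^ (n + 1))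
      ≤ lowerTail y ((1 + C e * (X - 1)) * (1 + C ((k : ℝ) / n) * (X - 1)) ^ n) := by
  have hn0 : (n : ℝ) ≠ 0 := by positivity
  have hsum : ∑ i, (Fin.cons e fun _ => (k : ℝ) / n : Fin (n + 1) → ℝ) i = e + k := by
    simp only [Fin.sum_univ_succ, Fin.cons_zero, Fin.cons_succ, Finset.sum_const,
      Finset.card_univ, Fintype.card_fin, nsmul_eq_mul]
    field_simp
  have hp : ∀ i, (Fin.cons e fun _ => (k : ℝ) / n : Fin (n + 1) → ℝ) i ∈ Set.Icc (0 : ℝ) 1 := by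
    refine Fin.cases (by simpa using he) fun i => ?_
    have hkn : (k : ℝ) ≤ n := by exact_mod_cast hk
    rw [Fin.cons_succ]
    exact ⟨by positivity, div_le_one_of_le₀ hkn (by positivity)⟩
  have := lowerTail_binomial_le hp (y := y) (by rw [hsum]; exact hy)
  rw [hsum, bernoulliGF_univ_cons, Fintype.card_fin] at this
  simpa [bernoulliGF] using this

/-- The mass that the binomial law with integer mean `k` gives to `{0, …, k}`. -/
noncomputable def binomialHead (n k : ℕ) : ℝ :=
  lowerTail k ((1 + C ((k : ℝ) / n) * (X - 1)) ^ n)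

/-- Comparison with the binomial law of `n` trials with an impossible trial added. -/
lemma binomialHead_succ_left_le {n k : ℕ} (hn : 1 ≤ n) (hk : k ≤ n) :
    binomialHead (n + 1) k ≤ binomialHead n k := by
  have := lowerTail_succ_pow_le hn hk (e := 0) (by simp) (y := k) (by simp)
  simpa [binomialHead] using this

/-- Comparison with the binomial law of `n` trials with a certain trial added. -/
lemma binomialHead_succ_succ_le {n k : ℕ} (hn : 1 ≤ n) (hk : k ≤ n) :
    binomialHead (n + 1) (k + 1) ≤ binomialHead n k := by
  have := lowerTail_succ_pow_le hn hk (e := 1) (by simp) (y := k + 1) (by simp [add_comm])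
  have h1 : (1 + C 1 * (X - 1) : ℝ[X]) = X := by rw [C_1]; ring
  rw [h1, lowerTail_succ_X_mul, add_comm (1 : ℝ)] at this
  simpa [binomialHead] using this

lemma binomialHead_anti_left {m n k : ℕ} (hm : 1 ≤ m) (hk : k ≤ m) (hmn : m ≤ n) :
    binomialHead n k ≤ binomialHead m k := by
  induction n, hmn using Nat.le_induction with
  | base => exact le_rfl
  | succ n hmn ih => exact (binomialHead_succ_left_le (by omega) (by omega)).trans ih

lemma binomialHead_eq_sum (n k : ℕ) :
    binomialHead n k
      = ∑ i ∈ Finset.range (k + 1), (bernsteinPolynomial ℝ n i).eval ((k : ℝ) / n) := by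
  simp only [binomialHead, lowerTail_apply, coeff_one_add_C_mul_pow]

lemma binomialHead_two_one : binomialHead 2 1 = 3 / 4 := by
  simp [binomialHead_eq_sum, Finset.sum_range_succ, bernsteinPolynomial]
  norm_num

lemma binomialHead_three_two : binomialHead 3 2 = 19 / 27 := by
  simp [binomialHead_eq_sum, Finset.sum_range_succ, bernsteinPolynomial]
  norm_num [Nat.choose]

lemma binomialHead_le_of_two_le {n k : ℕ} (hk : 2 ≤ k) (hkn : k < n) :
    binomialHead n k ≤ 19 / 27 := by
  induction k, hk using Nat.le_induction generalizing n with
  | base =>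
    rw [← binomialHead_three_two]
    exact binomialHead_anti_left (by norm_num) (by norm_num) hkn
  | succ k hk ih =>
    obtain ⟨m, rfl⟩ : ∃ m, n = m + 1 := ⟨n - 1, by omega⟩
    exact (binomialHead_succ_succ_le (by omega) (by omega)).trans (ih (by omega))

lemma binomialHead_succ_one (m : ℕ) :
    binomialHead (m + 1) 1 = (1 - 1 / (m + 1 : ℝ)) ^ m * (2 - 1 / (m + 1 : ℝ)) := by
  have hm : (m + 1 : ℝ) ≠ 0 := by positivity
  simp only [binomialHead_eq_sum, Finset.sum_range_succ, bernsteinPolynomial, eval_mul,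
    eval_natCast, eval_pow, eval_X, eval_sub, eval_one, Finset.range_zero, Finset.sum_empty]
  simp only [Nat.choose_zero_right, Nat.choose_one_right, Nat.sub_zero, Nat.add_sub_cancel,
    pow_succ, Nat.cast_add, Nat.cast_one, pow_zero]
  field_simp
  ring

/-- The limit of the decreasing sequence `binomialHead n 1` is `2 / e > 19 / 27`. -/
lemma le_binomialHead_one {n : ℕ} (hn : 3 ≤ n) : 19 / 27 ≤ binomialHead n 1 := by
  rcases le_total n 12 with h | h
    -- For `n ≤ 12` the value at `n = 12` is the least; beyond, `(2 - 1 / n) / e` suffices.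
  · refine le_trans ?_ (binomialHead_anti_left (by omega) (by omega) h)
    rw [binomialHead_succ_one 11]
    norm_num
  · obtain ⟨m, rfl⟩ : ∃ m, n = m + 1 := ⟨n - 1, by omega⟩
    have hm : (11 : ℝ) ≤ m := by exact_mod_cast (show 11 ≤ m by omega)
    have hm0 : (0 : ℝ) < m := by linarith
    rw [binomialHead_succ_one]
    have h1 : Real.exp (-1) ≤ (1 - 1 / (m + 1 : ℝ)) ^ m := by
      have h2 : (1 - 1 / (m + 1 : ℝ)) = (1 + 1 / m : ℝ)⁻¹ := by
        field_simp
        ring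
      rw [h2, inv_pow, Real.exp_neg]
      refine inv_anti₀ (by positivity) ?_
      calc (1 + 1 / m : ℝ) ^ m ≤ Real.exp (1 / m) ^ m :=
            pow_le_pow_left₀ (by positivity) (by linarith [Real.add_one_le_exp (1 / m : ℝ)]) m
        _ = Real.exp 1 := by rw [← Real.exp_nat_mul]; congr 1; field_simp
    have h3 : (1 / 2.7182818286 : ℝ) ≤ Real.exp (-1) := by
      rw [Real.exp_neg, one_div]
      exact inv_anti₀ (Real.exp_pos 1) Real.exp_one_lt_d9.le
    have h4 : 1 / (m + 1 : ℝ) ≤ 1 / 12 := by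
      apply one_div_le_one_div_of_le <;> linarith
    calc (19 / 27 : ℝ) ≤ 1 / 2.7182818286 * (23 / 12) := by norm_num
      _ ≤ (1 - 1 / (m + 1 : ℝ)) ^ m * (2 - 1 / (m + 1 : ℝ)) :=
        mul_le_mul (h3.trans h1) (by linarith) (by norm_num) ((Real.exp_pos _).le.trans h1)

/-- Among the binomial laws of `n` trials with integer mean `k ∈ {1, …, n - 1}`, the mass of
`{0, …, k}` is largest for `k = 1`. -/
lemma binomialHead_le_binomialHead_one {n k : ℕ} (hk : 1 ≤ k) (hkn : k < n) :
    binomialHead n k ≤ binomialHead n 1 := by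
  rcases hk.eq_or_lt with rfl | hk
  · exact le_rfl
  · exact (binomialHead_le_of_two_le hk hkn).trans (le_binomialHead_one (by omega))

lemma binomialHead_one_le {n : ℕ} (hn : 2 ≤ n) : binomialHead n 1 ≤ 3 / 4 := by
  rw [← binomialHead_two_one]
  exact binomialHead_anti_left (by norm_num) (by norm_num) hn

/-- The complement of a lower tail of a binomial law. -/
lemma one_sub_lowerTail_pow (n y : ℕ) (hy : y ≤ n) (a : ℝ) :
    1 - lowerTail y ((1 + C a * (X - 1)) ^ n)
      = ∑ k ∈ Finset.Icc (y + 1) n, (bernsteinPolynomial ℝ n k).eval a := by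
  have h := congrArg (eval a) (bernsteinPolynomial.sum ℝ n)
  rw [eval_finsetSum, eval_one] at h
  rw [lowerTail_apply, ← h,
    ← Finset.sum_range_add_sum_Ico _ (show y + 1 ≤ n + 1 by omega)]
  simp only [coeff_one_add_C_mul_pow, add_sub_cancel_left]
  rfl

lemma binomial_real_Icc_eq_one_sub {n x : ℕ} (hx : 1 ≤ x) (hxn : x ≤ n) (p : I) :
    (binomial n p).real (Set.Icc x n)
      = 1 - lowerTail (x - 1) ((1 + C (p : ℝ) * (X - 1)) ^ n) := by
  rw [one_sub_lowerTail_pow n (x - 1) (by omega), Nat.sub_add_cancel hx, binomial_real_Icc]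

lemma strictMono_binomial_real_Icc {n x : ℕ} (hx : 1 ≤ x) (hxn : x ≤ n) :
    StrictMono fun p : I => (binomial n p).real (Set.Icc x n) := by
  obtain ⟨m, rfl⟩ : ∃ m, n = m + 1 := ⟨n - 1, by omega⟩
  obtain ⟨y, rfl⟩ : ∃ y, x = y + 1 := ⟨x - 1, by omega⟩
  set q : ℝ[X] := ∑ k ∈ Finset.Icc (y + 1) (m + 1), bernsteinPolynomial ℝ (m + 1) k with hq
  have hmono : StrictMonoOn (fun t : ℝ => q.eval t) (Set.Icc 0 1) := by
    refine strictMonoOn_of_deriv_pos (convex_Icc 0 1) q.continuous.continuousOn fun t ht => ?_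
    rw [interior_Icc] at ht
    rw [Polynomial.deriv, hq, derivative_bernstein_tail m y (by omega)]
    have h1 : 0 < 1 - t := by linarith [ht.2]
    have h2 : (0 : ℝ) < m.choose y := by exact_mod_cast Nat.choose_pos (by omega)
    have h3 := ht.1
    simp only [bernsteinPolynomial, eval_smul, eval_mul, eval_natCast, eval_pow, eval_X, eval_sub,
      eval_one, smul_eq_mul]
    positivity
  intro a b hab
  simp only [binomial_real_Icc]
  simpa only [hq, eval_finsetSum] using hmono a.2 b.2 hab

lemma betaThreshold_eq (n : ℕ) : betaThreshold n = binomialHead n 1 := by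
  have h : ({0, 1} : Set ℕ) = ((Finset.range 2 : Finset ℕ) : Set ℕ) := by
    ext k
    simp
    omega
  rw [betaThreshold, h, ← sum_measureReal_singleton, binomialHead_eq_sum]
  refine Finset.sum_congr rfl fun k _ => ?_
  rw [binomial_real_singleton]
  simp [bernsteinPolynomial]

/-- In the relevant range of confidence levels, the values `x` close to or below the mean have a
large binomial upper tail, except possibly for `x = 1`. -/
lemma lt_binomial_real_Icc_of_lt_mean_add_one {n : ℕ} {β : ℝ} (hβ : β ∈ Set.Ioo (0 : ℝ) 1)
    (h : 2 * betaThreshold n - 1 ≤ β ∨ n = 1) {x : ℕ} (hx : 1 ≤ x) (hxn : x ≤ n) {q : I}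
    (hq : (x : ℝ) < n * (q : ℝ) + 1) (hx1 : x = 1 → 1 ≤ n * (q : ℝ)) :
    1 - (1 + β) / 2 < (binomial n q).real (Set.Icc x n) := by
  rcases (show n = 1 ∨ 2 ≤ n by omega) with rfl | hn
  · obtain rfl : x = 1 := by omega
    have hq1 : q = 1 := Subtype.ext (le_antisymm q.2.2 (by simpa using hx1 rfl))
    have : (binomial 1 q).real (Set.Icc 1 1) = 1 := by
      rw [hq1, binomial_real_Icc]
      simp [bernsteinPolynomial]
    rw [this]
    linarith [hβ.1]
  have h' : 2 * binomialHead n 1 - 1 ≤ β := by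
    rw [← betaThreshold_eq]
    exact h.resolve_right (by omega)
  have hn0 : (0 : ℝ) < n := by positivity
  have hmem : ∀ k : ℕ, k ≤ n → (k : ℝ) / n ∈ I := fun k hk =>
    ⟨by positivity, div_le_one_of_le₀ (by exact_mod_cast hk) hn0.le⟩
  have hhead : ∀ (k : ℕ) (hk : k ≤ n), k + 1 ≤ n →
      (binomial n ⟨(k : ℝ) / n, hmem k hk⟩).real (Set.Icc (k + 1) n) = 1 - binomialHead n k := by
    intro k hk hk'
    rw [binomial_real_Icc_eq_one_sub (by omega) hk', binomialHead, Nat.add_sub_cancel]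
  obtain rfl | ⟨k, hk, rfl⟩ : x = 1 ∨ ∃ k, 1 ≤ k ∧ x = k + 1 := by
    by_cases h : x = 1
    · exact Or.inl h
    · exact Or.inr ⟨x - 1, by omega, by omega⟩
    -- For `x = 1` the mean is at least `1`: compare with `{2, …, n}` and the mean `1`.
  · have hle : (⟨((1 : ℕ) : ℝ) / n, hmem 1 (by omega)⟩ : I) ≤ q := by
      rw [← Subtype.coe_le_coe, div_le_iff₀ hn0]
      linarith [hx1 rfl, Nat.cast_one (R := ℝ)]
    have h1 := (strictMono_binomial_real_Icc (le_refl 1) hxn).monotone hle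
    have h2 := hhead 1 (by omega) hn
    have h3 : (binomial n ⟨((1 : ℕ) : ℝ) / n, hmem 1 (by omega)⟩).real (Set.Icc 2 n)
        < (binomial n ⟨((1 : ℕ) : ℝ) / n, hmem 1 (by omega)⟩).real (Set.Icc 1 n) := by
      rw [binomial_real_Icc, binomial_real_Icc, ← Finset.add_sum_Ioc_eq_sum_Icc hxn,
        ← Finset.Icc_add_one_left_eq_Ioc]
      simp only [one_add_one_eq_two, lt_add_iff_pos_left]
      have hlt : (0 : ℝ) < 1 - 1 / n := by
        rw [sub_pos, div_lt_one hn0]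
        exact_mod_cast hn
      simp only [bernsteinPolynomial, eval_mul, eval_natCast, eval_pow, eval_X, eval_sub,
        eval_one, Nat.cast_one, Nat.choose_one_right]
      positivity
    linarith
  · have hlt : (⟨(k : ℝ) / n, hmem k (by omega)⟩ : I) < q := by
      rw [← Subtype.coe_lt_coe, div_lt_iff₀ hn0]
      push_cast at hq
      linarith
    have h1 := strictMono_binomial_real_Icc (by omega) hxn hlt
    simp only [hhead k (by omega) hxn] at h1
    linarith [binomialHead_le_binomialHead_one hk (by omega : k < n)]

/-! ### Bernoulli convolutions as measures -/

instance isProbabilityMeasure_bernoulliLaw (p : I) : IsProbabilityMeasure (bernoulliLaw p) := by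
  unfold bernoulliLaw
  infer_instance

instance isProbabilityMeasure_bernoulliConvolution :
    (n : ℕ) → (p : Fin n → I) → IsProbabilityMeasure (bernoulliConvolution n p)
  | 0, _ => inferInstanceAs (IsProbabilityMeasure (Measure.dirac 0))
  | n + 1, p => by
    have := isProbabilityMeasure_bernoulliConvolution n fun j => p j.castSucc
    unfold bernoulliConvolution
    infer_instance

lemma conv_bernoulliLaw (μ : Measure ℕ) [IsFiniteMeasure μ] (p : I) :
    Measure.conv μ (bernoulliLaw p)
      = toNNReal p • μ.map (1 + ·) + toNNReal (σ p) • μ := by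
  rw [Measure.conv_comm, bernoulliLaw, bernoulliMeasure_def, Measure.add_conv]
  simp only [ENNReal.smul_def, Measure.conv_smul_left, Measure.dirac_conv, zero_add,
    Measure.map_id']

lemma conv_bernoulliLaw_real_singleton (μ : Measure ℕ) [IsFiniteMeasure μ] (p : I) (k : ℕ) :
    (Measure.conv μ (bernoulliLaw p)).real {k}
      = p * μ.real ((1 + ·) ⁻¹' {k}) + (1 - p) * μ.real {k} := by
  rw [conv_bernoulliLaw, measureReal_add_apply, measureReal_nnreal_smul_apply,
    measureReal_nnreal_smul_apply, map_measureReal_apply (by fun_prop) (by measurability)]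
  simp

lemma bernoulliConvolution_real_singleton (n : ℕ) (p : Fin n → I) (k : ℕ) :
    (bernoulliConvolution n p).real {k}
      = (bernoulliGF Finset.univ fun j => (p j : ℝ)).coeff k := by
  induction n generalizing k with
  | zero =>
    rcases eq_or_ne k 0 with rfl | hk
    · simp [bernoulliConvolution, bernoulliGF, Measure.real]
    · simp [bernoulliConvolution, bernoulliGF, coeff_one, Measure.real, hk, hk.symm]
  | succ n ih =>
    have hGF : (bernoulliGF Finset.univ fun j => (p j : ℝ))
        = bernoulliGF Finset.univ (fun j : Fin n => (p j.castSucc : ℝ))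
          + C (p (Fin.last n) : ℝ)
            * ((X - 1) * bernoulliGF Finset.univ (fun j : Fin n => (p j.castSucc : ℝ))) := by
      simp only [bernoulliGF, Fin.prod_univ_castSucc]
      ring
    rw [bernoulliConvolution, conv_bernoulliLaw_real_singleton, hGF, coeff_add, coeff_C_mul, ih]
    cases k with
    | zero =>
      have : ((1 + ·) ⁻¹' {0} : Set ℕ) = ∅ := by ext; simp
      rw [this]
      simp [sub_mul]
      ring
    | succ k =>
      have : ((1 + ·) ⁻¹' {k + 1} : Set ℕ) = {k} := by ext; simp; omega
      rw [this, ih, coeff_succ_X_sub_one_mul]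
      ring

lemma bernoulliConvolution_real_finset (n : ℕ) (p : Fin n → I) (s : Finset ℕ) :
    (bernoulliConvolution n p).real s
      = ∑ k ∈ s, (bernoulliGF Finset.univ fun j => (p j : ℝ)).coeff k := by
  rw [← sum_measureReal_singleton]
  exact Finset.sum_congr rfl fun k _ => bernoulliConvolution_real_singleton n p k

lemma natDegree_one_add_C_mul_le (a : ℝ) : (1 + C a * (X - 1) : ℝ[X]).natDegree ≤ 1 := by
  compute_degree

lemma natDegree_bernoulliGF_le {ι : Type*} (s : Finset ι) (p : ι → ℝ) :
    (bernoulliGF s p).natDegree ≤ s.card := by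
  refine (natDegree_prod_le _ _).trans ?_
  refine (Finset.sum_le_card_nsmul _ _ 1 fun i _ => natDegree_one_add_C_mul_le _).trans ?_
  simp

lemma bernoulliConvolution_real_range (n : ℕ) (p : Fin n → I) :
    (bernoulliConvolution n p).real (Finset.range (n + 1)) = 1 := by
  have hd := natDegree_bernoulliGF_le Finset.univ fun j => (p j : ℝ)
  rw [Finset.card_univ, Fintype.card_fin] at hd
  have h := eval_eq_sum_range' (Nat.lt_succ_of_le hd) (1 : ℝ)
  simp only [one_pow, mul_one] at h
  rw [bernoulliConvolution_real_finset, ← Nat.succ_eq_add_one, ← h]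
  simp [bernoulliGF, eval_prod]

lemma reflect_bernoulliGF {ι : Type*} (s : Finset ι) (p : ι → ℝ) :
    reflect s.card (bernoulliGF s p) = bernoulliGF s fun i => 1 - p i := by
  classical
  induction s using Finset.induction_on with
  | empty => simp [bernoulliGF]
  | insert i s hi ih =>
    have h1 : reflect 1 (1 + C (p i) * (X - 1) : ℝ[X]) = 1 + C (1 - p i) * (X - 1) := by
      have : (1 + C (p i) * (X - 1) : ℝ[X]) = C (p i) * X ^ 1 + C (1 - p i) := by
        rw [C_sub, C_1]
        ring
      rw [this, reflect_add, reflect_C_mul_X_pow, reflect_C, revAt_le le_rfl, C_sub, C_1]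
      ring
    rw [Finset.card_insert_of_notMem hi, bernoulliGF, Finset.prod_insert hi, ← bernoulliGF,
      add_comm, reflect_mul _ _ (natDegree_one_add_C_mul_le _) (natDegree_bernoulliGF_le s p), ih,
      h1, bernoulliGF, bernoulliGF, Finset.prod_insert hi]

/-- Exchanging successes and failures. -/
lemma bernoulliConvolution_real_singleton_symm (n : ℕ) (p : Fin n → I) {k : ℕ} (hk : k ≤ n) :
    (bernoulliConvolution n fun j => σ (p j)).real {k}
      = (bernoulliConvolution n p).real {n - k} := by
  have h := reflect_bernoulliGF Finset.univ fun j => (p j : ℝ)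
  rw [Finset.card_univ, Fintype.card_fin] at h
  simp only [bernoulliConvolution_real_singleton, coe_symm_eq]
  rw [← h, coeff_reflect, revAt_le hk]

lemma averageProb_symm {n : ℕ} (hn : 1 ≤ n) (p : Fin n → I) :
    averageProb (fun j => σ (p j)) = σ (averageProb p) := by
  have hn0 : (n : ℝ) ≠ 0 := by positivity
  apply Subtype.ext
  simp only [averageProb, coe_symm_eq, Finset.sum_sub_distrib, Finset.sum_const, Finset.card_univ,
    Fintype.card_fin, nsmul_eq_mul]
  field_simp

/-! ### Coverage of the Clopper–Pearson intervals -/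

/-- The observations at which the Clopper–Pearson upray of level `γ` misses the parameter `q`,
described by binomial tails instead of the bound `clopperPearsonBound`; the two descriptions agree
by `mem_clopperPearsonUpray_iff`. -/
noncomputable def missedObservations (n : ℕ) (γ : ℝ) (q : I) : Finset ℕ :=
  {x ∈ Finset.Icc 1 n | (binomial n q).real (Set.Icc x n) ≤ 1 - γ}

lemma mem_clopperPearsonUpray_iff {n : ℕ} {γ : ℝ} (hγ : γ ∈ Set.Ioo (0 : ℝ) 1) (x : Fin (n + 1))
    (q : I) : q ∈ clopperPearsonUpray n γ x ↔ (x : ℕ) ∉ missedObservations n γ q := by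
  rw [clopperPearsonUpray]
  split_ifs with hx
  · simp [hx, missedObservations]
  · have hx1 : 1 ≤ (x : ℕ) := by
      rw [Nat.one_le_iff_ne_zero]
      exact fun h => hx (Fin.ext h)
    have hxn : (x : ℕ) ≤ n := by omega
    have hg := (binomial_tail_eq_iff hγ hx1 hxn (clopperPearsonBound n γ x)).2 rfl
    have hlt := (strictMono_binomial_real_Icc hx1 hxn).lt_iff_lt
      (a := clopperPearsonBound n γ x) (b := q)
    simp only [hg] at hlt
    have hq1 : q ≤ 1 := q.2.2
    simp [missedObservations, hx1, hxn, ← hlt, hq1]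

lemma mem_clopperPearsonDownray_iff {n : ℕ} {γ : ℝ} (hγ : γ ∈ Set.Ioo (0 : ℝ) 1) (x : Fin (n + 1))
    (q : I) : q ∈ clopperPearsonDownray n γ x ↔ n - x ∉ missedObservations n γ (σ q) := by
  have h := mem_clopperPearsonUpray_iff hγ x.rev (σ q)
  rw [Fin.val_rev, Nat.add_sub_add_right] at h
  rw [← h, clopperPearsonDownray]
  constructor
  · rintro ⟨r, hr, rfl⟩
    simpa using hr
  · exact fun hq => ⟨σ q, hq, symm_symm q⟩

lemma ordConnected_clopperPearsonTwoSided (n : ℕ) (β : ℝ) (x : Fin (n + 1)) :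
    (clopperPearsonTwoSided n β x).OrdConnected := by
  have hup : ∀ (γ : ℝ) (x : Fin (n + 1)), (clopperPearsonUpray n γ x).OrdConnected := by
    intro γ x
    rw [clopperPearsonUpray]
    split_ifs
    · exact Set.ordConnected_univ
    · exact Set.ordConnected_Ioc
  refine (hup _ x).inter ?_
  rw [clopperPearsonDownray, Set.image_eq_preimage_of_inverse symm_symm symm_symm]
  exact (hup _ _).preimage_anti strictAnti_symm.antitone

lemma bernoulliConvolution_real_Icc_le (n : ℕ) (p : Fin n → I) {x : ℕ} (hx : 1 ≤ x) :
    (bernoulliConvolution n p).real (Finset.Icc x n)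
      ≤ 1 - lowerTail (x - 1) (bernoulliGF Finset.univ fun j => (p j : ℝ)) := by
  have hdisj : Disjoint (Finset.range x) (Finset.Icc x n) := by
    rw [Finset.disjoint_left]
    intro k hk hk'
    simp only [Finset.mem_range, Finset.mem_Icc] at hk hk'
    omega
  have h : (bernoulliConvolution n p).real ((Finset.range x ∪ Finset.Icc x n : Finset ℕ) : Set ℕ)
      ≤ 1 := measureReal_le_one
  rw [bernoulliConvolution_real_finset, Finset.sum_union hdisj] at h
  rw [lowerTail_apply, Nat.sub_add_cancel hx, bernoulliConvolution_real_finset]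
  linarith

lemma mul_coe_averageProb {n : ℕ} (hn : 1 ≤ n) (p : Fin n → I) :
    n * (averageProb p : ℝ) = ∑ j, (p j : ℝ) := by
  have hn0 : (n : ℝ) ≠ 0 := by positivity
  simp only [averageProb]
  field_simp

/-- Outside the exceptional case of a miss at `1` with mean below `1`, every missed observation is
at least `1` above the mean, and Hoeffding's inequality applies. -/
lemma real_missedObservations_le {n : ℕ} (hn : 1 ≤ n) {β : ℝ} (hβ : β ∈ Set.Ioo (0 : ℝ) 1)
    (h : 2 * betaThreshold n - 1 ≤ β ∨ n = 1) (p : Fin n → I)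
    (hex : 1 ∈ missedObservations n ((1 + β) / 2) (averageProb p) →
      1 ≤ n * (averageProb p : ℝ)) :
    (bernoulliConvolution n p).real (missedObservations n ((1 + β) / 2) (averageProb p))
      ≤ (1 - β) / 2 := by
  rcases (missedObservations n ((1 + β) / 2) (averageProb p)).eq_empty_or_nonempty with he | he
  · rw [he]
    simpa using by linarith [hβ.2]
  set x := (missedObservations n ((1 + β) / 2) (averageProb p)).min' he with hxdef
  have hxm := Finset.min'_mem _ he
  rw [← hxdef] at hxm
  obtain ⟨hx, hxle⟩ := Finset.mem_filter.1 hxm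
  obtain ⟨hx1, hxn⟩ := Finset.mem_Icc.1 hx
  have hmean : n * (averageProb p : ℝ) + 1 ≤ x := by
    by_contra hlt
    refine absurd hxle (not_le.2 ?_)
    exact lt_binomial_real_Icc_of_lt_mean_add_one hβ h hx1 hxn (not_le.1 hlt)
      fun h1 => hex (by rwa [h1] at hxm)
  have hsub : missedObservations n ((1 + β) / 2) (averageProb p) ⊆ Finset.Icc x n := fun y hy =>
    Finset.mem_Icc.2 ⟨Finset.min'_le _ y hy, (Finset.mem_Icc.1 (Finset.mem_filter.1 hy).1).2⟩
  have hH := lowerTail_binomial_le (p := fun j => (p j : ℝ)) (fun j => (p j).2) (y := x - 1) (by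
    rw [← mul_coe_averageProb hn, Nat.cast_sub hx1, Nat.cast_one]
    linarith)
  rw [Fintype.card_fin, show (∑ j, (p j : ℝ)) / n = averageProb p from rfl] at hH
  rw [binomial_real_Icc_eq_one_sub hx1 hxn] at hxle
  have hm := measureReal_mono (μ := bernoulliConvolution n p) (Finset.coe_subset.2 hsub)
  linarith [bernoulliConvolution_real_Icc_le n p hx1]

lemma one_sub_sum_le_prod_one_sub {ι : Type*} (s : Finset ι) {p : ι → ℝ}
    (hp : ∀ i ∈ s, p i ∈ Set.Icc (0 : ℝ) 1) : 1 - ∑ i ∈ s, p i ≤ ∏ i ∈ s, (1 - p i) := by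
  classical
  induction s using Finset.induction_on with
  | empty => simp
  | insert i s hi ih =>
    have hs := fun j hj => hp j (Finset.mem_insert_of_mem hj)
    have h1 := hp i (Finset.mem_insert_self i s)
    have h2 := ih hs
    have h3 : ∏ j ∈ s, (1 - p j) ≤ 1 :=
      Finset.prod_le_one (fun j hj => by linarith [(hs j hj).2])
        fun j hj => by linarith [(hs j hj).1]
    rw [Finset.sum_insert hi, Finset.prod_insert hi]
    nlinarith [h1.1]

lemma one_sub_pow_le_one_sub_half {t : ℝ} (ht : 0 ≤ t) (ht1 : t ≤ 1) {n : ℕ} (h : n * t ≤ 1) :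
    (1 - t) ^ n ≤ 1 - n * t / 2 := by
  have h1 : (1 - t) ^ n * (1 + t) ^ n ≤ 1 := by
    rw [← mul_pow]
    exact pow_le_one₀ (by nlinarith) (by nlinarith)
  have h2 : 1 + n * t ≤ (1 + t) ^ n := one_add_mul_le_pow (by linarith) n
  have h3 : 0 ≤ (1 - t) ^ n := pow_nonneg (by linarith) n
  have h4 : 0 ≤ n * t := by positivity
  have h5 : (1 - t) ^ n * (1 + n * t) ≤ 1 := (mul_le_mul_of_nonneg_left h2 h3).trans h1
  nlinarith

/-- In the exceptional case the upray may miss with twice the nominal probability, but then the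
downray never misses. -/
lemma exceptional_missedObservations {n : ℕ} (hn : 1 ≤ n) {β : ℝ} (hβ : β ∈ Set.Ioo (0 : ℝ) 1)
    (p : Fin n → I) (h1 : 1 ∈ missedObservations n ((1 + β) / 2) (averageProb p))
    (hmean : n * (averageProb p : ℝ) < 1) :
    (bernoulliConvolution n p).real (missedObservations n ((1 + β) / 2) (averageProb p)) ≤ 1 - β ∧
    missedObservations n ((1 + β) / 2) (σ (averageProb p)) = ∅ := by
  have htail := (Finset.mem_filter.1 h1).2
  rw [binomial_real_Icc_eq_one_sub le_rfl hn, lowerTail_apply] at htail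
  simp only [Nat.sub_self, zero_add, Finset.range_one, Finset.sum_singleton,
    coeff_one_add_C_mul_pow, bernsteinPolynomial, eval_mul, eval_natCast, eval_pow, eval_X,
    eval_sub, eval_one, Nat.choose_zero_right, Nat.cast_one, pow_zero, mul_one, one_mul,
    Nat.sub_zero] at htail
  constructor
  · have hsub : missedObservations n ((1 + β) / 2) (averageProb p) ⊆ Finset.Icc 1 n :=
      Finset.filter_subset _ _
    have h2 := measureReal_mono (μ := bernoulliConvolution n p) (Finset.coe_subset.2 hsub)
    have h3 := bernoulliConvolution_real_Icc_le n p (le_refl 1)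
    have h4 : lowerTail 0 (bernoulliGF Finset.univ fun j => (p j : ℝ)) = ∏ j, (1 - (p j : ℝ)) := by
      rw [lowerTail_apply]
      simp [bernoulliGF, coeff_zero_prod, sub_eq_add_neg]
    have h5 := one_sub_sum_le_prod_one_sub Finset.univ (p := fun j => (p j : ℝ)) fun j _ => (p j).2
    have h6 := one_sub_pow_le_one_sub_half (averageProb p).2.1 (averageProb p).2.2 hmean.le
    rw [Nat.sub_self, h4] at h3
    rw [← mul_coe_averageProb hn] at h5
    linarith
  · refine Finset.filter_eq_empty_iff.2 fun x hx => not_le.2 ?_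
    obtain ⟨hx1, hxn⟩ := Finset.mem_Icc.1 hx
    have h2 : (binomial n (σ (averageProb p))).real {n}
        ≤ (binomial n (σ (averageProb p))).real (Set.Icc x n) :=
      measureReal_mono (by simpa using hxn)
    rw [binomial_real_singleton] at h2
    simp only [coe_symm_eq, Nat.sub_self, pow_zero, mul_one, Nat.choose_self, Nat.cast_one] at h2
    linarith [hβ.1]

lemma real_missedObservations_add_le {n : ℕ} (hn : 1 ≤ n) {β : ℝ} (hβ : β ∈ Set.Ioo (0 : ℝ) 1)
    (h : 2 * betaThreshold n - 1 ≤ β ∨ n = 1) (p : Fin n → I) :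
    (bernoulliConvolution n p).real (missedObservations n ((1 + β) / 2) (averageProb p))
      + (bernoulliConvolution n fun j => σ (p j)).real
        (missedObservations n ((1 + β) / 2) (σ (averageProb p))) ≤ 1 - β := by
  by_cases h1 : 1 ∈ missedObservations n ((1 + β) / 2) (averageProb p) →
      1 ≤ n * (averageProb p : ℝ)
  · by_cases h2 : 1 ∈ missedObservations n ((1 + β) / 2) (averageProb fun j => σ (p j)) →
        1 ≤ n * (averageProb (fun j => σ (p j)) : ℝ)
    · have h3 := real_missedObservations_le hn hβ h p h1
      have h4 := real_missedObservations_le hn hβ h _ h2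
      rw [averageProb_symm hn] at h4
      linarith
    · push Not at h2
      obtain ⟨h3, h4⟩ := exceptional_missedObservations hn hβ _ h2.1 h2.2
      rw [averageProb_symm hn] at h3 h4
      rw [symm_symm] at h4
      rw [h4]
      simpa using h3
  · push Not at h1
    obtain ⟨h3, h4⟩ := exceptional_missedObservations hn hβ _ h1.1 h1.2
    rw [h4]
    simpa using h3

lemma isConfidenceRegion_clopperPearsonTwoSided {n : ℕ} (hn : 1 ≤ n) {β : ℝ}
    (hβ : β ∈ Set.Ioo (0 : ℝ) 1) (h : 2 * betaThreshold n - 1 ≤ β ∨ n = 1) :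
    IsConfidenceRegion (bernoulliConvolution n) averageProb β (clopperPearsonTwoSided n β) := by
  intro p
  have hγ : (1 + β) / 2 ∈ Set.Ioo (0 : ℝ) 1 := ⟨by linarith [hβ.1], by linarith [hβ.2]⟩
  set μ := bernoulliConvolution n p with hμ
  set F := missedObservations n ((1 + β) / 2) (averageProb p) with hF
  set G := missedObservations n ((1 + β) / 2) (σ (averageProb p)) with hG
  have hGn : ∀ x ∈ G, x ≤ n := fun x hx => (Finset.mem_Icc.1 (Finset.mem_filter.1 hx).1).2
  have hGsymm : μ.real ((G.image (n - ·) : Finset ℕ) : Set ℕ)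
      = (bernoulliConvolution n fun j => σ (p j)).real G := by
    rw [← sum_measureReal_singleton, ← sum_measureReal_singleton, Finset.sum_image]
    · exact Finset.sum_congr rfl fun k hk =>
        (bernoulliConvolution_real_singleton_symm n p (hGn k hk)).symm
    · intro a ha b hb hab
      have := hGn a ha
      have := hGn b hb
      simp only at hab
      omega
  have hcover : ((Finset.range (n + 1) : Finset ℕ) : Set ℕ)
      ⊆ (Fin.val '' {x : Fin (n + 1) | averageProb p ∈ clopperPearsonTwoSided n β x} ∪ F)
        ∪ ((G.image (n - ·) : Finset ℕ) : Set ℕ) := by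
    intro x hx
    have hx' : x < n + 1 := by simpa using hx
    by_cases hxF : x ∈ F
    · exact Or.inl (Or.inr hxF)
    by_cases hxG : n - x ∈ G
    · exact Or.inr (Finset.mem_coe.2 (Finset.mem_image.2 ⟨n - x, hxG, by omega⟩))
    · exact Or.inl (Or.inl ⟨⟨x, hx'⟩, ⟨(mem_clopperPearsonUpray_iff hγ _ _).2 hxF,
        (mem_clopperPearsonDownray_iff hγ _ _).2 hxG⟩, rfl⟩)
  have h1 := measureReal_mono (μ := μ) hcover
  rw [bernoulliConvolution_real_range] at h1
  have h2 := real_missedObservations_add_le hn hβ h p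
  rw [← hGsymm] at h2
  linarith [measureReal_union_le (μ := μ)
      (Fin.val '' {x : Fin (n + 1) | averageProb p ∈ clopperPearsonTwoSided n β x} ∪ F)
      ((G.image (n - ·) : Finset ℕ) : Set ℕ),
    measureReal_union_le (μ := μ)
      (Fin.val '' {x : Fin (n + 1) | averageProb p ∈ clopperPearsonTwoSided n β x}) F]

theorem theorem3 (n : ℕ) (hn : 1 ≤ n) (β : ℝ) (hβ : β ∈ Set.Ioo (0 : ℝ) 1) :
    (2 * betaThreshold n - 1 ≤ β ∨ n = 1 →
      IsConfidenceInterval (bernoulliConvolution n) averageProb β (clopperPearsonTwoSided n β)) ∧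
    (1 / 2 ≤ β →
      (2 * betaThreshold n - 1 ≤ β ∨ n = 1) ∧
      IsConfidenceInterval (bernoulliConvolution n) averageProb β
        (clopperPearsonTwoSided n β)) := by
  have main : 2 * betaThreshold n - 1 ≤ β ∨ n = 1 →
      IsConfidenceInterval (bernoulliConvolution n) averageProb β (clopperPearsonTwoSided n β) :=
    fun h => ⟨isConfidenceRegion_clopperPearsonTwoSided hn hβ h,
      ordConnected_clopperPearsonTwoSided n β⟩
  refine ⟨main, fun hβ2 => ?_⟩
  have hcond : 2 * betaThreshold n - 1 ≤ β ∨ n = 1 := by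
    rcases hn.eq_or_lt with rfl | hn2
    · exact Or.inr rfl
    · rw [betaThreshold_eq]
      exact Or.inl (by linarith [binomialHead_one_le hn2])
  exact ⟨hcond, main hcond⟩
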